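/- Conventions. $|E|$ denotes Lebesgue measure and $\|\cdot\|_\infty$ the essential supremum norm. Let $S_0(\mathbb R^n)$ be the class of all measurable and almost everywhere finite functions $g$ on $\mathbb R^n$ such that $\lambda_g(s)=|\{x:|g(x)|>s\}|<\infty$ for every $s>0$. Let $g^*$ be the non-increasing rearrangement of $g$, that is, the non-increasing (right-continuous) function $g^*(t)=\inf\{s\ge 0:\lambda_g(s)\le t\}$ on $(0,\infty)$, which is equimeasurable with $|g|$. For $1\le p<\infty$ put $$\|g\|_{p,1}=\int_0^\infty t^{1/p}g^*(t)\,\frac{dt}{t},$$ and let $L^{p,1}(\mathbb R)$ be the Lorentz space of all $g\in S_0(\mathbb R)$ with $\|g\|_{p,1}<\infty$. For $0<\alpha\le 1$, let $\operatorname{Lip}\alpha$ be the class of all $\varphi\in L^\infty(\mathbb R)$ with $$\|\varphi\|^*_{\operatorname{Lip}\alpha}=\sup_{h>0}h^{-\alpha}\|\varphi(\cdot+h)-\varphi(\cdot)\|_\infty<\infty,\qquad\text{and put } \|\varphi\|_{\operatorname{Lip}\alpha}=\|\varphi\|_\infty+\|\varphi\|^*_{\operatorname{Lip}\alpha}.$$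 For a function $f$ on $\mathbb R^2$ write $f_y=f(\cdot,y)$ and $f_x=f(x,\cdot)$ for its sections. Let $\mathcal U_p(\mathbb R^2)$ be the space of all measurable (real- or complex-valued) functions $f$ on $\mathbb R^2$ such that $f_y\in\operatorname{Lip}\frac1p$ for almost all $y$, $f_x\in\operatorname{Lip}\frac1p$ for almost all $x$, and both functions $y\mapsto\|f_y\|_{\operatorname{Lip}\frac1p}$ and $x\mapsto\|f_x\|_{\operatorname{Lip}\frac1p}$ belong to $L^{p,1}(\mathbb R)$. For a continuous function $g$ on $\mathbb R^2$ and $\delta>0$ put $$\omega(g;\delta)=\sup_{(x,y)\in\mathbb R^2,\;0\le h,k\le\delta}|g(x+h,y+k)-g(x,y)|.$$ **Theorem.** Let $1\le p<\infty$. There is a constant $c$, depending only on $p$, such that the following holds for every $f\in\mathcal U_p(\mathbb R^2)$. The function $f$ belongs to $S_0(\mathbb R^2)$ and agrees almost everywhere with a bounded, uniformly continuous function $\bar f$ on $\mathbb R^2$. Moreover, with $$\varphi_1(y)=\|f_y\|^*_{\operatorname{Lip}\frac1p},\qquad \varphi_2(x)=\|f_x\|^*_{\operatorname{Lip}\frac1p},$$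 one has $$\|f\|_\infty\le c\left(\|\varphi_1\|_{p,1}+\|\varphi_2\|_{p,1}\right)$$ and, for every $\delta>0$, $$\omega(\bar f;\delta)\le c\int_0^\delta\left[\varphi_1^*(t)+\varphi_2^*(t)\right]t^{1/p-1}\,dt.$$ -/

import Mathlib

open MeasureTheory Set
open scoped ENNReal NNReal

namespace LipSections

section Rearrangement

variable {α E : Type*} [MeasurableSpace α] [ENorm E]

/-- The distribution function `λ_f(y) = μ {x : |f x| > y}`. -/
noncomputable def distribFn (f : α → E) (μ : Measure α) (y : ℝ≥0∞) : ℝ≥0∞ :=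
  μ {x | y < ‖f x‖ₑ}

/-- The non-increasing rearrangement `f*(t) = inf {y ≥ 0 : λ_f(y) ≤ t}`, used for `t > 0`:
the right-continuous non-increasing function on `(0, ∞)` that is equimeasurable with `|f|`. -/
noncomputable def rearr (f : α → E) (μ : Measure α) (t : ℝ) : ℝ≥0∞ :=
  sInf {y : ℝ≥0∞ | distribFn f μ y ≤ ENNReal.ofReal t}

/-- The class `S₀`: measurable, almost everywhere finite functions such that
`|{|f| > y}| < ∞` for every `y > 0`. Functions with values in `ℝ≥0∞` are allowed. -/
structure MemS0 [TopologicalSpace E] (f : α → E) (μ : Measure α) : Prop where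
  aestronglyMeasurable : AEStronglyMeasurable f μ
  ae_finite : ∀ᵐ x ∂μ, ‖f x‖ₑ < ∞
  distribFn_lt_top : ∀ y : ℝ, 0 < y → distribFn f μ (ENNReal.ofReal y) < ∞

/-- The Lorentz norm `‖f‖_{p,q} = (∫₀^∞ (t^{1/p} f*(t))^q dt/t)^{1/q}`, with values in `[0, ∞]`. -/
noncomputable def lorentzNorm (f : α → E) (p q : ℝ) (μ : Measure α) : ℝ≥0∞ :=
  (∫⁻ t in Ioi (0 : ℝ),
    (ENNReal.ofReal (t ^ (1 / p)) * rearr f μ t) ^ q * ENNReal.ofReal (1 / t)) ^ (1 / q)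

/-- Membership in the Lorentz space `L^{p,q}`. -/
structure MemLorentz [TopologicalSpace E] (f : α → E) (p q : ℝ) (μ : Measure α) : Prop where
  memS0 : MemS0 f μ
  lorentzNorm_lt_top : lorentzNorm f p q μ < ∞

end Rearrangement

section Lipschitz

variable {𝕜 : Type*} [RCLike 𝕜]

/-- The seminorm `‖φ‖*_{Lip a} = sup_{h > 0} h^{-a} ‖φ(· + h) - φ‖_∞`, where `‖·‖_∞` is the
essential supremum, with values in `[0, ∞]`. -/
noncomputable def lipSeminorm (a : ℝ) (φ : ℝ → 𝕜) : ℝ≥0∞ :=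
  ⨆ (h : ℝ) (_ : 0 < h),
    ENNReal.ofReal (h ^ (-a)) * eLpNorm (fun t => φ (t + h) - φ t) ∞ volume

/-- The norm `‖φ‖_{Lip a} = ‖φ‖_∞ + ‖φ‖*_{Lip a}`. -/
noncomputable def lipNorm (a : ℝ) (φ : ℝ → 𝕜) : ℝ≥0∞ :=
  eLpNorm φ ∞ volume + lipSeminorm a φ

/-- The class `Lip a` of all `φ ∈ L^∞(ℝ)` with `‖φ‖*_{Lip a} < ∞`. -/
structure MemLip (a : ℝ) (φ : ℝ → 𝕜) : Prop where
  memLp : MemLp φ ∞ volume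
  lipSeminorm_lt_top : lipSeminorm a φ < ∞

/-- The section `f_y = f(·, y)`. -/
def ySection (f : ℝ × ℝ → 𝕜) (y : ℝ) : ℝ → 𝕜 := fun x => f (x, y)

/-- The section `f_x = f(x, ·)`. -/
def xSection (f : ℝ × ℝ → 𝕜) (x : ℝ) : ℝ → 𝕜 := fun y => f (x, y)

/-- The space `𝒰_p(ℝ²)`: measurable `f` such that almost all sections `f_y`, `f_x` belong to
`Lip (1/p)` and the functions `y ↦ ‖f_y‖_{Lip (1/p)}`, `x ↦ ‖f_x‖_{Lip (1/p)}` belong to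
`L^{p,1}(ℝ)`. -/
structure MemU (p : ℝ) (f : ℝ × ℝ → 𝕜) : Prop where
  aestronglyMeasurable : AEStronglyMeasurable f volume
  ae_memLip_ySection : ∀ᵐ y : ℝ, MemLip (1 / p) (ySection f y)
  ae_memLip_xSection : ∀ᵐ x : ℝ, MemLip (1 / p) (xSection f x)
  memLorentz_ySection : MemLorentz (fun y => lipNorm (1 / p) (ySection f y)) p 1 volume
  memLorentz_xSection : MemLorentz (fun x => lipNorm (1 / p) (xSection f x)) p 1 volume

/-- The modulus of continuity `ω(f; δ) = sup_{0 ≤ h, k ≤ δ} |f(x + h, y + k) - f(x, y)|`, the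
supremum being also over all `(x, y) ∈ ℝ²`, with values in `[0, ∞]`. -/
noncomputable def modCont (f : ℝ × ℝ → 𝕜) (δ : ℝ) : ℝ≥0∞ :=
  ⨆ (x : ℝ) (y : ℝ) (h ∈ Icc 0 δ) (k ∈ Icc 0 δ), ‖f (x + h, y + k) - f (x, y)‖ₑ

end Lipschitz

end LipSections

namespace LipSections

/-! ### Rearrangements and good sets. -/

section Rearrangement

variable {α : Type*} [MeasurableSpace α] {μ : Measure α} {φ ψ : α → ℝ≥0∞}

/-! At scale `r`, discard the lines on which the Hölder constant exceeds `φᵢ*(r)`. In each direction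
they have measure at most `r`, so a square of side `2r` keeps a good part of area at least `r²`, a
quarter of the square. Two generic points, good at scales `r` and `s ≤ r`, are joined by one
horizontal and one vertical segment on good lines, so `f` varies between them by at most `(φ₁*(s) +
φ₂*(s)) * dist ^ (1/p)` (`ae_ae_enorm_sub_le_of_mem_goodSet`).

Chaining through the good parts of the squares of radius `r, r/2, r/4, ...` about `z` gives a dyadic
sum that telescopes into the integral of `(φ₁* + φ₂*) t^(1/p-1)` (`ae_exists_enorm_sub_le`). By
Lebesgue density the chain ends at values close to `f z`, for almost every `z`. Two such chains
linked at scale `r` give the modulus of continuity on a set of full measure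
(`enorm_sub_le_of_dist_le`), and density extends it. Since `f` is in `S₀`, a chain from a very large
square can start where `f` is nearly zero; this is the sup bound (`enorm_le_of_distribFn_lt_top`).
-/

/-- Continuity from below along increasing unions: the infimum is attained. This needs no
measurability of `φ`, which matters because the Lipschitz seminorms of sections are not shown to be
measurable. -/
theorem distribFn_rearr_le (φ : α → ℝ≥0∞) (μ : Measure α) (t : ℝ) :
    distribFn φ μ (rearr φ μ t) ≤ ENNReal.ofReal t := by
  have hne : {y : ℝ≥0∞ | distribFn φ μ y ≤ ENNReal.ofReal t}.Nonempty :=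
    ⟨∞, by simp [distribFn]⟩
  obtain ⟨u, hu, hlim, hmem⟩ := exists_seq_tendsto_sInf hne (OrderBot.bddBelow _)
  have hset : {x | rearr φ μ t < ‖φ x‖ₑ} = ⋃ n, {x | u n < ‖φ x‖ₑ} := by
    ext x
    simp only [mem_ofPred_eq, mem_iUnion]
    constructor
    · intro hx
      exact (hlim.eventually_lt_const hx).exists
    · rintro ⟨n, hn⟩
      exact (sInf_le (hmem n)).trans_lt hn
  have hmono : Monotone fun n => {x | u n < ‖φ x‖ₑ} := fun m n hmn x hx =>
    (hu hmn).trans_lt hx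
  rw [distribFn, hset, hmono.measure_iUnion]
  exact iSup_le hmem

theorem rearr_antitone (φ : α → ℝ≥0∞) (μ : Measure α) : Antitone (rearr φ μ) := fun _ _ hst =>
  sInf_le_sInf fun _ hy => le_trans hy (ENNReal.ofReal_le_ofReal hst)

theorem rearr_mono (h : ∀ x, φ x ≤ ψ x) (t : ℝ) : rearr φ μ t ≤ rearr ψ μ t :=
  sInf_le_sInf fun _ hy => le_trans (measure_mono fun x hx => lt_of_lt_of_le hx (h x)) hy

/-- A measurable set with complement of measure at most `t` on which `φ ≤ φ*(t)`. -/
def goodSet (φ : α → ℝ≥0∞) (μ : Measure α) (t : ℝ) : Set α :=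
  (toMeasurable μ {x | rearr φ μ t < φ x})ᶜ

theorem measurableSet_goodSet (φ : α → ℝ≥0∞) (μ : Measure α) (t : ℝ) :
    MeasurableSet (goodSet φ μ t) :=
  (measurableSet_toMeasurable _ _).compl

theorem measure_compl_goodSet_le (φ : α → ℝ≥0∞) (μ : Measure α) (t : ℝ) :
    μ (goodSet φ μ t)ᶜ ≤ ENNReal.ofReal t := by
  rw [goodSet, compl_compl, measure_toMeasurable]
  exact distribFn_rearr_le φ μ t

theorem le_rearr_of_mem_goodSet {t : ℝ} {x : α} (hx : x ∈ goodSet φ μ t) :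
    φ x ≤ rearr φ μ t := by
  by_contra! h
  exact hx (subset_toMeasurable μ _ h)

theorem lorentzNorm_one (φ : ℝ → ℝ≥0∞) (p : ℝ) :
    lorentzNorm φ p 1 volume =
      ∫⁻ t in Ioi (0 : ℝ), rearr φ volume t * ENNReal.ofReal (t ^ (1 / p - 1)) := by
  rw [lorentzNorm, div_one, ENNReal.rpow_one]
  refine setLIntegral_congr_fun measurableSet_Ioi fun t (ht : 0 < t) => ?_
  simp only [ENNReal.rpow_one]
  rw [mul_comm (ENNReal.ofReal _), mul_assoc, ← ENNReal.ofReal_mul (by positivity),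
    Real.rpow_sub_one ht.ne', div_eq_mul_one_div (t ^ (1 / p))]

end Rearrangement

/-! ### Area of the good part of a square. -/

section GoodSquares

/-- The part of the square centred at `z` lying in the product of the good sets. -/
def goodSquare (φ₁ φ₂ : ℝ → ℝ≥0∞) (z : ℝ × ℝ) (r : ℝ) : Set (ℝ × ℝ) :=
  (goodSet φ₂ volume r ×ˢ goodSet φ₁ volume r) ∩ Metric.closedBall z r

theorem ofReal_le_volume_goodSet_inter (φ : ℝ → ℝ≥0∞) (x : ℝ) {r : ℝ} (hr : 0 ≤ r) :
    ENNReal.ofReal r ≤ volume (goodSet φ volume r ∩ Metric.closedBall x r) := by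
  have h1 : volume (Metric.closedBall x r) ≤
      volume (goodSet φ volume r ∩ Metric.closedBall x r) + ENNReal.ofReal r := by
    refine le_trans (measure_mono ?_) ((measure_union_le _ (goodSet φ volume r)ᶜ).trans
      (add_le_add_right (measure_compl_goodSet_le φ volume r) _))
    intro y hy
    by_cases h : y ∈ goodSet φ volume r
    · exact Or.inl ⟨h, hy⟩
    · exact Or.inr h
  rw [Real.volume_closedBall, two_mul, ENNReal.ofReal_add hr hr] at h1
  exact (ENNReal.add_le_add_iff_right ENNReal.ofReal_ne_top).1 h1

theorem measurableSet_goodSquare (φ₁ φ₂ : ℝ → ℝ≥0∞) (z : ℝ × ℝ) (r : ℝ) :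
    MeasurableSet (goodSquare φ₁ φ₂ z r) :=
  ((measurableSet_goodSet _ _ _).prod (measurableSet_goodSet _ _ _)).inter
    Metric.isClosed_closedBall.measurableSet

theorem ofReal_sq_le_volume_goodSquare (φ₁ φ₂ : ℝ → ℝ≥0∞) (z : ℝ × ℝ) {r : ℝ} (hr : 0 ≤ r) :
    ENNReal.ofReal (r ^ 2) ≤ volume (goodSquare φ₁ φ₂ z r) := by
  rw [goodSquare, ← closedBall_prod_same, prod_inter_prod, Measure.volume_eq_prod,
    Measure.prod_prod, sq, ENNReal.ofReal_mul hr]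
  exact mul_le_mul' (ofReal_le_volume_goodSet_inter _ _ hr) (ofReal_le_volume_goodSet_inter _ _ hr)

theorem volume_closedBall_prod (z : ℝ × ℝ) {r : ℝ} (hr : 0 ≤ r) :
    volume (Metric.closedBall z r) = ENNReal.ofReal (4 * r ^ 2) := by
  rw [← closedBall_prod_same, Measure.volume_eq_prod, Measure.prod_prod, Real.volume_closedBall,
    Real.volume_closedBall, ← ENNReal.ofReal_mul (by positivity)]
  ring_nf

end GoodSquares

/-! ### Oscillation between generic good points. -/

section Holder

variable {𝕜 : Type*} [RCLike 𝕜] {a : ℝ}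

/-- The exceptional null set depends on `h`; Fubini exchanges the quantifiers over `x` and `h`, and
then `u = x + h`. -/
theorem ae_ae_enorm_sub_le {g : ℝ → 𝕜} (hg : StronglyMeasurable g) {C : ℝ≥0∞}
    (H : ∀ h : ℝ, 0 < h → ∀ᵐ x, ‖g (x + h) - g x‖ₑ ≤ C * ENNReal.ofReal (h ^ a)) :
    ∀ᵐ x, ∀ᵐ u, ‖g x - g u‖ₑ ≤ C * ENNReal.ofReal (|x - u| ^ a) := by
  have hgm := hg.measurable
  have H' : ∀ᵐ h : ℝ, ∀ᵐ x, ‖g (x + h) - g x‖ₑ ≤ C * ENNReal.ofReal (|h| ^ a) := by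
    have h0 : ∀ᵐ h : ℝ, h ≠ 0 := by simp [ae_iff]
    filter_upwards [h0] with h hh
    rcases hh.lt_or_gt with hneg | hpos
    · have := (measurePreserving_add_right (volume : Measure ℝ) h).quasiMeasurePreserving.ae
        (H (-h) (by linarith))
      filter_upwards [this] with x hx
      rw [abs_of_neg hneg, enorm_sub_rev]
      simpa using hx
    · simpa only [abs_of_pos hpos] using H h hpos
  rw [Measure.ae_ae_comm] at H'
  · filter_upwards [H'] with x hx
    have := (measurePreserving_sub_right (volume : Measure ℝ) x).quasiMeasurePreserving.ae hx
    filter_upwards [this] with u hu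
    rw [enorm_sub_rev, abs_sub_comm]
    simpa using hu
  · apply measurableSet_le <;> fun_prop

/-- `f (·, y)` is, for almost every `y`, almost everywhere Hölder with exponent `a` and
constant `φ y`. -/
def AEHolderSections (a : ℝ) (f : ℝ × ℝ → 𝕜) (φ : ℝ → ℝ≥0∞) : Prop :=
  ∀ᵐ y : ℝ, ∀ h : ℝ, 0 < h → ∀ᵐ x : ℝ, ‖f (x + h, y) - f (x, y)‖ₑ ≤ φ y * ENNReal.ofReal (h ^ a)

/-- On the measurable good set the possibly nonmeasurable `φ y` is replaced by the constant `φ*(r)`,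
so that Fubini applies. -/
theorem AEHolderSections.ae_ae {f : ℝ × ℝ → 𝕜} {φ : ℝ → ℝ≥0∞} (H : AEHolderSections a f φ)
    (hf : StronglyMeasurable f) (r : ℝ) :
    ∀ᵐ z : ℝ × ℝ, ∀ᵐ w : ℝ × ℝ, z.2 ∈ goodSet φ volume r →
      ‖f (z.1, z.2) - f (w.1, z.2)‖ₑ ≤ rearr φ volume r * ENNReal.ofReal (|z.1 - w.1| ^ a) := by
  have hfm := hf.measurable
  have hB := measurableSet_goodSet φ volume r
  have h1 : ∀ᵐ y : ℝ, ∀ᵐ x : ℝ, ∀ᵐ u : ℝ, y ∈ goodSet φ volume r →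
      ‖f (x, y) - f (u, y)‖ₑ ≤ rearr φ volume r * ENNReal.ofReal (|x - u| ^ a) := by
    filter_upwards [H] with y hy
    by_cases hyB : y ∈ goodSet φ volume r
    · have := ae_ae_enorm_sub_le (a := a) (g := fun x => f (x, y)) (by fun_prop) hy
      filter_upwards [this] with x hx
      filter_upwards [hx] with u hu _
      exact hu.trans (mul_le_mul_left (le_rearr_of_mem_goodSet hyB) _)
    · simp [hyB]
  have hmeas : MeasurableSet {q : (ℝ × ℝ) × ℝ | q.1.2 ∈ goodSet φ volume r →
      ‖f (q.1.1, q.1.2) - f (q.2, q.1.2)‖ₑ ≤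
        rearr φ volume r * ENNReal.ofReal (|q.1.1 - q.2| ^ a)} := by
    refine MeasurableSet.imp (hB.preimage (by fun_prop)) ?_
    apply measurableSet_le <;> fun_prop
  have h2 : ∀ᵐ y : ℝ, ∀ᵐ q : ℝ × ℝ, y ∈ goodSet φ volume r →
      ‖f (q.1, y) - f (q.2, y)‖ₑ ≤ rearr φ volume r * ENNReal.ofReal (|q.1 - q.2| ^ a) := by
    filter_upwards [h1] with y hy
    rw [Measure.volume_eq_prod, Measure.ae_prod_iff_ae_ae]
    · exact hy
    · exact hmeas.preimage (f := fun q : ℝ × ℝ => ((q.1, y), q.2)) (by fun_prop)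
  have h3 : ∀ᵐ q : ℝ × (ℝ × ℝ), q.1 ∈ goodSet φ volume r →
      ‖f (q.2.1, q.1) - f (q.2.2, q.1)‖ₑ ≤
        rearr φ volume r * ENNReal.ofReal (|q.2.1 - q.2.2| ^ a) := by
    rw [Measure.volume_eq_prod, Measure.ae_prod_iff_ae_ae]
    · exact h2
    · exact hmeas.preimage (f := fun q : ℝ × (ℝ × ℝ) => ((q.2.1, q.1), q.2.2)) (by fun_prop)
  have mp : MeasurePreserving (fun q : (ℝ × ℝ) × ℝ => (q.1.2, (q.1.1, q.2))) volume volume :=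
    volume_preserving_prodAssoc.comp
      ((Measure.measurePreserving_swap (μ := (volume : Measure ℝ)) (ν := (volume : Measure ℝ))).prod
        (MeasurePreserving.id (volume : Measure ℝ)))
  have h4 := Measure.ae_ae_of_ae_prod (mp.quasiMeasurePreserving.ae h3)
  filter_upwards [h4] with z hz
  -- The coordinate `w.2` is a dummy.
  exact Measure.quasiMeasurePreserving_fst.ae hz

/-- Pass through the corner `(w.1, z.2)`: only the row of `z` and the column of `w` have to be good.
-/
theorem ae_ae_enorm_sub_le_of_mem_goodSet {f : ℝ × ℝ → 𝕜} {φ₁ φ₂ : ℝ → ℝ≥0∞}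
    (hf : StronglyMeasurable f) (ha : 0 ≤ a) (H₁ : AEHolderSections a f φ₁)
    (H₂ : AEHolderSections a (f ∘ Prod.swap) φ₂) {r s : ℝ} (hsr : s ≤ r) :
    ∀ᵐ z : ℝ × ℝ, ∀ᵐ w : ℝ × ℝ,
      z ∈ goodSet φ₂ volume r ×ˢ goodSet φ₁ volume r →
      w ∈ goodSet φ₂ volume s ×ˢ goodSet φ₁ volume s →
      ‖f z - f w‖ₑ ≤
        (rearr φ₁ volume s + rearr φ₂ volume s) * ENNReal.ofReal (dist z w ^ a) := by
  have hfm := hf.measurable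
  have h1 := H₁.ae_ae hf r
  have h2 := H₂.ae_ae (hf.comp_measurable measurable_swap) s
  have hB := measurableSet_goodSet φ₂ volume s
  have h3 : ∀ᵐ z : ℝ × ℝ, ∀ᵐ w : ℝ × ℝ, w.1 ∈ goodSet φ₂ volume s →
      ‖f (w.1, w.2) - f (w.1, z.2)‖ₑ ≤
        rearr φ₂ volume s * ENNReal.ofReal (|w.2 - z.2| ^ a) := by
    rw [Measure.ae_ae_comm]
    · have mp := (Measure.measurePreserving_swap (μ := (volume : Measure ℝ))
        (ν := (volume : Measure ℝ))).quasiMeasurePreserving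
      filter_upwards [mp.ae h2] with w hw
      filter_upwards [mp.ae hw] with z hz hmem
      exact hz hmem
    · refine MeasurableSet.imp (hB.preimage (by fun_prop)) ?_
      apply measurableSet_le <;> fun_prop
  filter_upwards [h1, h3] with z hz1 hz3
  filter_upwards [hz1, hz3] with w hw1 hw3 hz hw
  have e : f z - f w = (f (z.1, z.2) - f (w.1, z.2)) - (f (w.1, w.2) - f (w.1, z.2)) := by simp
  rw [e, add_mul]
  refine (enorm_sub_le).trans (add_le_add ?_ ?_)
  · refine (hw1 hz.2).trans (mul_le_mul' (rearr_antitone _ _ hsr) (ENNReal.ofReal_le_ofReal ?_))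
    refine Real.rpow_le_rpow (abs_nonneg _) ?_ ha
    rw [Prod.dist_eq]; exact le_max_left _ _
  · refine (hw3 hw.1).trans (mul_le_mul' le_rfl (ENNReal.ofReal_le_ofReal ?_))
    refine Real.rpow_le_rpow (abs_nonneg _) ?_ ha
    rw [Prod.dist_eq, abs_sub_comm]; exact le_max_right _ _

end Holder

open Filter Topology

/-! ### The telescoping inequality. -/

section WeightedIntegral

variable {a : ℝ} {Φ : ℝ → ℝ≥0∞}

/-- The integral `∫₀^r Φ(t) t^{a-1} dt`. -/
noncomputable def weightedInt (a : ℝ) (Φ : ℝ → ℝ≥0∞) (r : ℝ) : ℝ≥0∞ :=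
  ∫⁻ t in Ioc (0 : ℝ) r, Φ t * ENNReal.ofReal (t ^ (a - 1))

theorem weightedInt_mono (a : ℝ) (Φ : ℝ → ℝ≥0∞) : Monotone (weightedInt a Φ) := fun _ _ h =>
  lintegral_mono_set (Ioc_subset_Ioc_right h)

/-- On `(s/2, s]` the integrand is at least `Φ(s) s^(a-1)`, so this piece contributes at least `Φ(s)
s^a / 2`; as `4^a ≤ 4`, the factor 8 suffices. -/
theorem mul_ofReal_rpow_add_weightedInt_le (hΦ : Antitone Φ) (ha1 : a ≤ 1) {s : ℝ}
    (hs : 0 < s) :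
    Φ s * ENNReal.ofReal ((4 * s) ^ a) + 8 * weightedInt a Φ (s / 2) ≤ 8 * weightedInt a Φ s := by
  have hsplit : weightedInt a Φ s = weightedInt a Φ (s / 2) +
      ∫⁻ t in Ioc (s / 2) s, Φ t * ENNReal.ofReal (t ^ (a - 1)) := by
    rw [weightedInt, weightedInt, ← lintegral_union measurableSet_Ioc,
      Ioc_union_Ioc_eq_Ioc (by linarith) (by linarith)]
    exact Ioc_disjoint_Ioc_of_le le_rfl
  have hlow : Φ s * ENNReal.ofReal (s ^ a / 2) ≤
      ∫⁻ t in Ioc (s / 2) s, Φ t * ENNReal.ofReal (t ^ (a - 1)) := by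
    calc Φ s * ENNReal.ofReal (s ^ a / 2)
        = ∫⁻ _ in Ioc (s / 2) s, Φ s * ENNReal.ofReal (s ^ (a - 1)) := by
          rw [setLIntegral_const, Real.volume_Ioc, mul_assoc,
            ← ENNReal.ofReal_mul (by positivity), Real.rpow_sub_one hs.ne']
          congr 2
          field_simp
          ring
      _ ≤ _ := by
          refine setLIntegral_mono' measurableSet_Ioc fun t ht => ?_
          refine mul_le_mul' (hΦ ht.2) (ENNReal.ofReal_le_ofReal ?_)
          exact Real.rpow_le_rpow_of_nonpos (by linarith [ht.1]) ht.2 (by linarith)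
  have h4 : (4 * s) ^ a ≤ 8 * (s ^ a / 2) := by
    rw [Real.mul_rpow (by norm_num) hs.le]
    have : (4 : ℝ) ^ a ≤ 4 := by
      simpa using Real.rpow_le_rpow_of_exponent_le (by norm_num : (1 : ℝ) ≤ 4) ha1
    nlinarith [Real.rpow_pos_of_pos hs a]
  rw [hsplit, mul_add, add_comm]
  refine add_le_add le_rfl ?_
  calc Φ s * ENNReal.ofReal ((4 * s) ^ a)
      ≤ Φ s * ENNReal.ofReal (8 * (s ^ a / 2)) :=
        mul_le_mul' le_rfl (ENNReal.ofReal_le_ofReal h4)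
    _ = 8 * (Φ s * ENNReal.ofReal (s ^ a / 2)) := by
        rw [ENNReal.ofReal_mul (by norm_num), ENNReal.ofReal_ofNat]; ring
    _ ≤ _ := mul_le_mul' le_rfl hlow

end WeightedIntegral

/-! ### Approximate continuity almost everywhere. -/

section ApproxContinuity

variable {𝕜 : Type*} [RCLike 𝕜]

/-- At small scales around `z` the function `f` is close to `f z` on more than three quarters of
the square centred at `z`. -/
def IsMostlyContinuousAt (f : ℝ × ℝ → 𝕜) (z : ℝ × ℝ) : Prop :=
  ∀ ε : ℝ, 0 < ε → ∀ᶠ r in 𝓝[>] (0 : ℝ),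
    ENNReal.ofReal (3 * r ^ 2) < volume ({w | ‖f w - f z‖ < ε} ∩ Metric.closedBall z r)

/-- Lebesgue density for the preimages of countably many balls, with centres in a dense sequence and
radii `1/(m+1)`. -/
theorem ae_isMostlyContinuousAt (f : ℝ × ℝ → 𝕜) : ∀ᵐ z, IsMostlyContinuousAt f z := by
  have hd : ∀ᵐ z : ℝ × ℝ, ∀ m n : ℕ,
      z ∈ f ⁻¹' Metric.ball (TopologicalSpace.denseSeq 𝕜 n) (1 / (m + 1)) →
      Tendsto (fun r => volume (f ⁻¹' Metric.ball (TopologicalSpace.denseSeq 𝕜 n) (1 / (m + 1)) ∩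
        Metric.closedBall z r) / volume (Metric.closedBall z r)) (𝓝[>] 0) (𝓝 1) := by
    refine ae_all_iff.2 fun m => ae_all_iff.2 fun n => ?_
    exact ae_imp_of_ae_restrict (Besicovitch.ae_tendsto_measure_inter_div volume _)
  filter_upwards [hd] with z hz ε hε
  obtain ⟨m, hm⟩ := exists_nat_one_div_lt (half_pos hε)
  have hm0 : (0 : ℝ) < 1 / (m + 1) := by positivity
  obtain ⟨n, hn⟩ := (TopologicalSpace.denseRange_denseSeq 𝕜).exists_dist_lt (f z) hm0
  have ht := hz m n hn
  have h34 : (3 / 4 : ℝ≥0∞) < 1 := by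
    rw [ENNReal.div_lt_iff] <;> norm_num
  filter_upwards [ht.eventually_const_lt h34, self_mem_nhdsWithin] with r hr (hr0 : 0 < r)
  rw [volume_closedBall_prod z hr0.le] at hr
  have h4 : (0 : ℝ) < 4 * r ^ 2 := by positivity
  rw [ENNReal.lt_div_iff_mul_lt (Or.inl (ENNReal.ofReal_pos.2 h4).ne')
    (Or.inl ENNReal.ofReal_ne_top)] at hr
  have e : (3 / 4 : ℝ≥0∞) * ENNReal.ofReal (4 * r ^ 2) = ENNReal.ofReal (3 * r ^ 2) := by
    have : (3 / 4 : ℝ≥0∞) = ENNReal.ofReal (3 / 4) := by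
      rw [ENNReal.ofReal_div_of_pos (by norm_num)]; simp
    rw [this, ← ENNReal.ofReal_mul (by norm_num)]
    ring_nf
  rw [e] at hr
  refine hr.trans_le (measure_mono (inter_subset_inter_left _ fun w hw => ?_))
  have hw' : dist (f w) (TopologicalSpace.denseSeq 𝕜 n) < 1 / (m + 1) := hw
  change ‖f w - f z‖ < ε
  rw [← dist_eq_norm]
  linarith [dist_triangle_right (f w) (f z) (TopologicalSpace.denseSeq 𝕜 n)]

/-- More than three quarters of the square cannot avoid a quarter of it. -/
theorem IsMostlyContinuousAt.eventually_ne_zero {f : ℝ × ℝ → 𝕜} {z : ℝ × ℝ}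
    (hz : IsMostlyContinuousAt f z) (φ₁ φ₂ : ℝ → ℝ≥0∞) {ε : ℝ} (hε : 0 < ε) :
    ∀ᶠ r in 𝓝[>] (0 : ℝ), volume ({w | ‖f w - f z‖ < ε} ∩ goodSquare φ₁ φ₂ z r) ≠ 0 := by
  filter_upwards [hz ε hε, self_mem_nhdsWithin] with r hr (hr0 : 0 < r) h0
  have hsub : goodSquare φ₁ φ₂ z r ⊆ Metric.closedBall z r := inter_subset_right
  have hd : volume (Metric.closedBall z r \ goodSquare φ₁ φ₂ z r) ≤
      ENNReal.ofReal (3 * r ^ 2) := by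
    rw [measure_sdiff hsub (measurableSet_goodSquare _ _ _ _).nullMeasurableSet
      ((measure_mono hsub).trans_lt Metric.isBounded_closedBall.measure_lt_top).ne,
      volume_closedBall_prod z hr0.le]
    refine (tsub_le_tsub_left (ofReal_sq_le_volume_goodSquare φ₁ φ₂ z hr0.le) _).trans ?_
    rw [← ENNReal.ofReal_sub _ (by positivity)]
    exact ENNReal.ofReal_le_ofReal (by linarith)
  refine absurd hr (not_lt.2 ?_)
  calc volume ({w | ‖f w - f z‖ < ε} ∩ Metric.closedBall z r)
      ≤ volume ({w | ‖f w - f z‖ < ε} ∩ goodSquare φ₁ φ₂ z r) +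
          volume (Metric.closedBall z r \ goodSquare φ₁ φ₂ z r) := by
        refine (measure_mono ?_).trans (measure_union_le _ _)
        intro w hw
        by_cases h : w ∈ goodSquare φ₁ φ₂ z r
        · exact Or.inl ⟨hw.1, h⟩
        · exact Or.inr ⟨hw.2, h⟩
    _ ≤ _ := by rw [h0, zero_add]; exact hd

end ApproxContinuity

/-! ### Chaining over dyadic squares. -/

section Chaining

variable {𝕜 : Type*} [RCLike 𝕜] {a : ℝ} {f : ℝ × ℝ → 𝕜} {φ₁ φ₂ : ℝ → ℝ≥0∞}

/-- The integral `∫₀^r (φ₁*(t) + φ₂*(t)) t^{a-1} dt`. -/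
noncomputable def rearrInt (a : ℝ) (φ₁ φ₂ : ℝ → ℝ≥0∞) (r : ℝ) : ℝ≥0∞ :=
  weightedInt a (fun t => rearr φ₁ volume t + rearr φ₂ volume t) r

theorem rearr_add_mul_rpow_add_le (ha1 : a ≤ 1) {s : ℝ} (hs : 0 < s) :
    (rearr φ₁ volume s + rearr φ₂ volume s) * ENNReal.ofReal ((4 * s) ^ a) +
      8 * rearrInt a φ₁ φ₂ (s / 2) ≤ 8 * rearrInt a φ₁ φ₂ s :=
  mul_ofReal_rpow_add_weightedInt_le
    (Φ := fun t => rearr φ₁ volume t + rearr φ₂ volume t)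
    (fun _ _ h => add_le_add (rearr_antitone _ _ h) (rearr_antitone _ _ h)) ha1 hs

theorem volume_goodSquare_ne_zero (φ₁ φ₂ : ℝ → ℝ≥0∞) (z : ℝ × ℝ) {r : ℝ} (hr : 0 < r) :
    volume (goodSquare φ₁ φ₂ z r) ≠ 0 :=
  ((ENNReal.ofReal_pos.2 (by positivity)).trans_le
    (ofReal_sq_le_volume_goodSquare φ₁ φ₂ z hr.le)).ne'

/-- Each halving of the scale costs one term of the telescoping inequality. The intermediate points
are chosen generically in sets of positive measure, and the last one in `E`. -/
theorem ae_exists_enorm_sub_le (hf : StronglyMeasurable f) (ha : 0 < a) (ha1 : a ≤ 1)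
    (H₁ : AEHolderSections a f φ₁) (H₂ : AEHolderSections a (f ∘ Prod.swap) φ₂)
    (z : ℝ × ℝ) (E : Set (ℝ × ℝ)) (J : ℕ) :
    ∀ r : ℝ, 0 < r → volume (E ∩ goodSquare φ₁ φ₂ z (r / 2 ^ (J + 1))) ≠ 0 →
      ∀ᵐ z₀ : ℝ × ℝ, z₀ ∈ goodSquare φ₁ φ₂ z r →
        ∃ w ∈ E, ‖f z₀ - f w‖ₑ ≤ 8 * rearrInt a φ₁ φ₂ (r / 2) := by
  have step : ∀ r : ℝ, 0 < r → ∀ᵐ z₀ : ℝ × ℝ, ∀ᵐ w : ℝ × ℝ, z₀ ∈ goodSquare φ₁ φ₂ z r →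
      w ∈ goodSquare φ₁ φ₂ z (r / 2) →
      ‖f z₀ - f w‖ₑ ≤ (rearr φ₁ volume (r / 2) + rearr φ₂ volume (r / 2)) *
        ENNReal.ofReal ((4 * (r / 2)) ^ a) := by
    intro r hr
    filter_upwards [ae_ae_enorm_sub_le_of_mem_goodSet hf ha.le H₁ H₂ (half_le_self hr.le)]
      with z₀ hz₀
    filter_upwards [hz₀] with w hw hzr hwr
    refine (hw hzr.1 hwr.1).trans (mul_le_mul' le_rfl (ENNReal.ofReal_le_ofReal ?_))
    refine Real.rpow_le_rpow dist_nonneg ?_ ha.le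
    have h1 := Metric.mem_closedBall.1 hzr.2
    have h2 := Metric.mem_closedBall.1 hwr.2
    linarith [dist_triangle_right z₀ w z]
  induction J with
  | zero =>
    intro r hr hE
    filter_upwards [step r hr] with z₀ hz₀ hmem
    rw [zero_add, pow_one] at hE
    obtain ⟨w, hw, hle⟩ := ((frequently_ae_mem_iff.2 hE).and_eventually hz₀).exists
    refine ⟨w, hw.1, (hle hmem hw.2).trans ?_⟩
    exact le_self_add.trans (rearr_add_mul_rpow_add_le ha1 (half_pos hr))
  | succ J ih =>
    intro r hr hE
    have hE' : volume (E ∩ goodSquare φ₁ φ₂ z (r / 2 / 2 ^ (J + 1))) ≠ 0 := by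
      rwa [div_div, ← pow_succ']
    filter_upwards [step r hr] with z₀ hz₀ hmem
    obtain ⟨z₁, hz₁, hle, hw⟩ := ((frequently_ae_mem_iff.2
      (volume_goodSquare_ne_zero φ₁ φ₂ z (half_pos hr))).and_eventually
      (hz₀.and (ih (r / 2) (half_pos hr) hE'))).exists
    obtain ⟨w, hwE, hwle⟩ := hw hz₁
    refine ⟨w, hwE, ?_⟩
    calc ‖f z₀ - f w‖ₑ = ‖(f z₀ - f z₁) + (f z₁ - f w)‖ₑ := by rw [sub_add_sub_cancel]
      _ ≤ ‖f z₀ - f z₁‖ₑ + ‖f z₁ - f w‖ₑ := enorm_add_le _ _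
      _ ≤ _ := (add_le_add (hle hmem hz₁) hwle).trans
          (rearr_add_mul_rpow_add_le ha1 (half_pos hr))

theorem eventually_pow_div {P : ℝ → Prop} (hP : ∀ᶠ r in 𝓝[>] (0 : ℝ), P r) {r : ℝ} (hr : 0 < r) :
    ∃ J : ℕ, P (r / 2 ^ (J + 1)) := by
  have h1 : Tendsto (fun J : ℕ => r / 2 ^ (J + 1)) atTop (𝓝[>] 0) := by
    refine tendsto_nhdsWithin_iff.2 ⟨?_, Eventually.of_forall fun J => ?_⟩
    · refine (tendsto_const_nhds (x := r)).div_atTop ?_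
      exact (tendsto_pow_atTop_atTop_of_one_lt (by norm_num : (1 : ℝ) < 2)).comp
        (tendsto_add_atTop_nat 1)
    · simp only [mem_Ioi]; positivity
  exact (h1.eventually hP).exists

theorem IsMostlyContinuousAt.ae_enorm_sub_le {z : ℝ × ℝ} (hz : IsMostlyContinuousAt f z)
    (hf : StronglyMeasurable f) (ha : 0 < a) (ha1 : a ≤ 1)
    (H₁ : AEHolderSections a f φ₁) (H₂ : AEHolderSections a (f ∘ Prod.swap) φ₂)
    {r : ℝ} (hr : 0 < r) {ε : ℝ} (hε : 0 < ε) :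
    ∀ᵐ z₀ : ℝ × ℝ, z₀ ∈ goodSquare φ₁ φ₂ z r →
      ‖f z₀ - f z‖ₑ ≤ 8 * rearrInt a φ₁ φ₂ (r / 2) + ENNReal.ofReal ε := by
  obtain ⟨J, hJ⟩ := eventually_pow_div (hz.eventually_ne_zero φ₁ φ₂ hε) hr
  filter_upwards [ae_exists_enorm_sub_le hf ha ha1 H₁ H₂ z _ J r hr hJ] with z₀ hz₀ hmem
  obtain ⟨w, hwE, hw⟩ := hz₀ hmem
  have hwE' : ‖f w - f z‖ < ε := hwE
  calc ‖f z₀ - f z‖ₑ = ‖(f z₀ - f w) + (f w - f z)‖ₑ := by rw [sub_add_sub_cancel]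
    _ ≤ ‖f z₀ - f w‖ₑ + ‖f w - f z‖ₑ := enorm_add_le _ _
    _ ≤ _ := by
      refine add_le_add hw ?_
      rw [← ofReal_norm]
      exact ENNReal.ofReal_le_ofReal hwE'.le

theorem enorm_sub_le_of_dist_le (hf : StronglyMeasurable f) (ha : 0 < a) (ha1 : a ≤ 1)
    (H₁ : AEHolderSections a f φ₁) (H₂ : AEHolderSections a (f ∘ Prod.swap) φ₂)
    {z w : ℝ × ℝ} (hz : IsMostlyContinuousAt f z) (hw : IsMostlyContinuousAt f w)
    {r : ℝ} (hr : 0 < r) (hzw : dist z w ≤ 2 * r) :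
    ‖f z - f w‖ₑ ≤ 16 * rearrInt a φ₁ φ₂ r := by
  refine ENNReal.le_of_forall_pos_le_add fun ε hε _ => ?_
  have hε2 : (0 : ℝ) < ε / 2 := by positivity
  obtain ⟨z₀, hz₀, hle, hzw₀⟩ := ((frequently_ae_mem_iff.2
    (volume_goodSquare_ne_zero φ₁ φ₂ z hr)).and_eventually
    ((hz.ae_enorm_sub_le hf ha ha1 H₁ H₂ hr hε2).and
      (ae_ae_enorm_sub_le_of_mem_goodSet hf ha.le H₁ H₂ le_rfl))).exists
  obtain ⟨w₀, hw₀, hle', hzw₁⟩ := ((frequently_ae_mem_iff.2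
    (volume_goodSquare_ne_zero φ₁ φ₂ w hr)).and_eventually
    ((hw.ae_enorm_sub_le hf ha ha1 H₁ H₂ hr hε2).and hzw₀)).exists
  -- `r + 2r + r`; this link is the source of the factor 4 in the telescoping inequality.
  have hd : dist z₀ w₀ ≤ 4 * r := by
    have h1 := Metric.mem_closedBall.1 hz₀.2
    have h2 := Metric.mem_closedBall'.1 hw₀.2
    linarith [dist_triangle4 z₀ z w w₀]
  have hmid : ‖f z₀ - f w₀‖ₑ ≤ (rearr φ₁ volume r + rearr φ₂ volume r) *
      ENNReal.ofReal ((4 * r) ^ a) :=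
    (hzw₁ hz₀.1 hw₀.1).trans (mul_le_mul' le_rfl
      (ENNReal.ofReal_le_ofReal (Real.rpow_le_rpow dist_nonneg hd ha.le)))
  have hεε : ENNReal.ofReal (ε / 2) + ENNReal.ofReal (ε / 2) = (ε : ℝ≥0∞) := by
    rw [← ENNReal.ofReal_add hε2.le hε2.le, add_halves, ENNReal.ofReal_coe_nnreal]
  calc ‖f z - f w‖ₑ = ‖(f z - f z₀) + ((f z₀ - f w₀) + (f w₀ - f w))‖ₑ := by
        rw [sub_add_sub_cancel, sub_add_sub_cancel]
    _ ≤ ‖f z - f z₀‖ₑ + (‖f z₀ - f w₀‖ₑ + ‖f w₀ - f w‖ₑ) :=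
        (enorm_add_le _ _).trans (add_le_add le_rfl (enorm_add_le _ _))
    _ ≤ (8 * rearrInt a φ₁ φ₂ (r / 2) + ENNReal.ofReal (ε / 2)) +
          ((rearr φ₁ volume r + rearr φ₂ volume r) * ENNReal.ofReal ((4 * r) ^ a) +
          (8 * rearrInt a φ₁ φ₂ (r / 2) + ENNReal.ofReal (ε / 2))) := by
        rw [enorm_sub_rev (f z)]
        exact add_le_add (hle hz₀) (add_le_add hmid (hle' hw₀))
    _ = 8 * rearrInt a φ₁ φ₂ (r / 2) +
          ((rearr φ₁ volume r + rearr φ₂ volume r) * ENNReal.ofReal ((4 * r) ^ a) +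
          8 * rearrInt a φ₁ φ₂ (r / 2)) + ε := by rw [← hεε]; ring
    _ ≤ 8 * rearrInt a φ₁ φ₂ r + 8 * rearrInt a φ₁ φ₂ r + ε := by
        refine add_le_add (add_le_add (mul_le_mul' le_rfl (weightedInt_mono _ _ (by linarith)))
          (rearr_add_mul_rpow_add_le ha1 hr)) le_rfl
    _ = _ := by ring

theorem enorm_le_of_distribFn_lt_top (hf : StronglyMeasurable f) (ha : 0 < a) (ha1 : a ≤ 1)
    (H₁ : AEHolderSections a f φ₁) (H₂ : AEHolderSections a (f ∘ Prod.swap) φ₂)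
    (hS : ∀ y : ℝ, 0 < y → distribFn f volume (ENNReal.ofReal y) < ∞)
    {z : ℝ × ℝ} (hz : IsMostlyContinuousAt f z) {B : ℝ≥0∞}
    (hB : ∀ r, rearrInt a φ₁ φ₂ r ≤ B) :
    ‖f z‖ₑ ≤ 8 * B := by
  refine ENNReal.le_of_forall_pos_le_add fun ε hε _ => ?_
  have hε2 : (0 : ℝ) < ε / 2 := by positivity
  have hfin := hS _ hε2
  obtain ⟨r, hr1, hr⟩ : ∃ r : ℝ, 1 ≤ r ∧
      distribFn f volume (ENNReal.ofReal (ε / 2)) < ENNReal.ofReal (r ^ 2) := by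
    -- For finite measure `T`, one has `T < (T + 1)²`, so the good square is not covered by the
    -- superlevel set.
    refine ⟨(distribFn f volume (ENNReal.ofReal (ε / 2))).toReal + 1, by simp, ?_⟩
    rw [ENNReal.lt_ofReal_iff_toReal_lt hfin.ne]
    nlinarith [ENNReal.toReal_nonneg (a := distribFn f volume (ENNReal.ofReal (ε / 2)))]
  have hr0 : 0 < r := by linarith
  have hne : volume (goodSquare φ₁ φ₂ z r \ {x | ENNReal.ofReal (ε / 2) < ‖f x‖ₑ}) ≠ 0 := by
    have h1 := hr.trans_le (ofReal_sq_le_volume_goodSquare φ₁ φ₂ z hr0.le)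
    exact ((tsub_pos_of_lt h1).trans_le le_measure_sdiff).ne'
  obtain ⟨z₀, hz₀, hle⟩ := ((frequently_ae_mem_iff.2 hne).and_eventually
    (hz.ae_enorm_sub_le hf ha ha1 H₁ H₂ hr0 hε2)).exists
  have hz₀' : ‖f z₀‖ₑ ≤ ENNReal.ofReal (ε / 2) := not_lt.1 hz₀.2
  have hεε : ENNReal.ofReal (ε / 2) + ENNReal.ofReal (ε / 2) = (ε : ℝ≥0∞) := by
    rw [← ENNReal.ofReal_add hε2.le hε2.le, add_halves, ENNReal.ofReal_coe_nnreal]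
  calc ‖f z‖ₑ = ‖f z₀ - (f z₀ - f z)‖ₑ := by rw [sub_sub_cancel]
    _ ≤ ‖f z₀‖ₑ + ‖f z₀ - f z‖ₑ := enorm_sub_le
    _ ≤ ENNReal.ofReal (ε / 2) + (8 * rearrInt a φ₁ φ₂ (r / 2) + ENNReal.ofReal (ε / 2)) :=
        add_le_add hz₀' (hle hz₀.1)
    _ = 8 * rearrInt a φ₁ φ₂ (r / 2) + ε := by rw [← hεε]; ring
    _ ≤ 8 * B + ε := add_le_add (mul_le_mul' le_rfl (hB _)) le_rfl

end Chaining

/-- Absolute continuity of the integral. -/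
theorem weightedInt_tendsto_zero {a : ℝ} {Φ : ℝ → ℝ≥0∞}
    (h : ∫⁻ t in Ioi (0 : ℝ), Φ t * ENNReal.ofReal (t ^ (a - 1)) ≠ ∞) :
    Tendsto (weightedInt a Φ) (𝓝[>] 0) (𝓝 0) := by
  have hv : Tendsto ((volume.restrict (Ioi (0 : ℝ))) ∘ fun r : ℝ => Ioc 0 r) (𝓝[>] 0) (𝓝 0) := by
    have h1 : Tendsto (fun r : ℝ => ENNReal.ofReal r) (𝓝[>] 0) (𝓝 0) := by
      have := (ENNReal.continuous_ofReal.tendsto 0).mono_left (nhdsWithin_le_nhds (s := Ioi 0))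
      simpa using this
    refine tendsto_of_tendsto_of_tendsto_of_le_of_le tendsto_const_nhds h1
      (fun _ => zero_le) fun r => ?_
    refine (Measure.restrict_apply_le _ _).trans ?_
    simp
  refine (tendsto_setLIntegral_zero h hv).congr fun r => ?_
  rw [weightedInt, Measure.restrict_restrict measurableSet_Ioc,
    inter_eq_self_of_subset_left (fun x hx => hx.1)]

theorem lintegral_rearr_add (φ₁ φ₂ : ℝ → ℝ≥0∞) (p : ℝ) :
    ∫⁻ t in Ioi (0 : ℝ), (rearr φ₁ volume t + rearr φ₂ volume t) *
      ENNReal.ofReal (t ^ (1 / p - 1)) =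
      lorentzNorm φ₁ p 1 volume + lorentzNorm φ₂ p 1 volume := by
  rw [lorentzNorm_one, lorentzNorm_one, ← lintegral_add_left]
  · simp_rw [add_mul]
  · exact (rearr_antitone _ _).measurable.mul (by fun_prop)

theorem lorentzNorm_mono {φ ψ : ℝ → ℝ≥0∞} (h : ∀ x, φ x ≤ ψ x) (p : ℝ) :
    lorentzNorm φ p 1 volume ≤ lorentzNorm ψ p 1 volume := by
  rw [lorentzNorm_one, lorentzNorm_one]
  exact lintegral_mono fun t => mul_le_mul' (rearr_mono h t) le_rfl

/-! ### Extension from a dense set. -/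

section DenseExtension

variable {X E : Type*} [PseudoMetricSpace X] [NormedAddCommGroup E] [CompleteSpace E]

/-- The slack between `2 * r` and `r` lets a pair at distance at most `r` be approximated by pairs
of `D` inside the open set `dist < 2 * r`. -/
theorem exists_uniformContinuous_of_dense {f : X → E} {D : Set X} (hD : Dense D)
    {ω : ℝ → ℝ≥0∞} (hω : Tendsto ω (𝓝[>] 0) (𝓝 0))
    (h : ∀ z ∈ D, ∀ w ∈ D, ∀ r : ℝ, 0 < r → dist z w ≤ 2 * r → ‖f z - f w‖ₑ ≤ ω r) :
    ∃ F : X → E, UniformContinuous F ∧ (∀ z ∈ D, F z = f z) ∧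
      ∀ z w, ∀ r : ℝ, 0 < r → dist z w ≤ r → ‖F z - F w‖ₑ ≤ ω r := by
  have huc : UniformContinuous (fun z : D => f z) := by
    refine Metric.uniformContinuous_iff.2 fun ε hε => ?_
    obtain ⟨r, hr, hr0⟩ :=
      ((hω.eventually_lt_const (ENNReal.ofReal_pos.2 hε)).and self_mem_nhdsWithin).exists
    have hr0 : 0 < r := hr0
    refine ⟨r, hr0, fun {z w} hzw => ?_⟩
    have hzw' : dist (z : X) w < r := hzw
    have := (h z z.2 w w.2 r hr0 (by linarith)).trans_lt hr
    rw [← ofReal_norm] at this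
    rw [dist_eq_norm]
    exact (ENNReal.ofReal_lt_ofReal_iff hε).1 this
  have hF := hD.uniformContinuous_extend huc
  have hFD : ∀ z ∈ D, hD.extend (fun z : D => f z) z = f z := fun z hz =>
    hD.extend_of_ind huc ⟨z, hz⟩
  generalize hD.extend (fun z : D => f z) = F at hF hFD
  refine ⟨F, hF, hFD, fun z w r hr hzw => ?_⟩
  have hopen : IsOpen {q : X × X | dist q.1 q.2 < 2 * r} :=
    isOpen_lt (by fun_prop) continuous_const
  have hclosed : IsClosed {q : X × X |
      ‖F q.1 - F q.2‖ₑ ≤ ω r} := by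
    have := hF.continuous
    exact isClosed_le (by fun_prop) continuous_const
  have hmem : (z, w) ∈ closure ({q : X × X | dist q.1 q.2 < 2 * r} ∩ D ×ˢ D) := by
    refine hopen.inter_closure ⟨?_, (hD.prod hD) _⟩
    change dist z w < 2 * r
    linarith
  suffices hsub : {q : X × X | dist q.1 q.2 < 2 * r} ∩ D ×ˢ D ⊆ {q : X × X |
      ‖F q.1 - F q.2‖ₑ ≤ ω r} by
    have hzw' := closure_minimal hsub hclosed hmem
    rwa [mem_ofPred_eq] at hzw'
  rintro ⟨x, y⟩ ⟨hxy, hx, hy⟩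
  change ‖F x - F y‖ₑ ≤ ω r
  rw [hFD x hx, hFD y hy]
  exact h x hx y hy r hr (le_of_lt hxy)

end DenseExtension

/-! ### From sections to functions on the plane. -/

section Sections

theorem ae_ySection_eq {E : Type*} {f g : ℝ × ℝ → E} (hfg : f =ᵐ[volume] g) :
    ∀ᵐ y : ℝ, ∀ᵐ x : ℝ, f (x, y) = g (x, y) :=
  Measure.ae_ae_of_ae_prod
    ((Measure.measurePreserving_swap (μ := (volume : Measure ℝ))
      (ν := (volume : Measure ℝ))).quasiMeasurePreserving.ae hfg)

theorem ae_swap {E : Type*} {f g : ℝ × ℝ → E} (hfg : f =ᵐ[volume] g) : f ∘ Prod.swap =ᵐ[volume] g ∘ Prod.swap :=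
  (Measure.measurePreserving_swap (μ := (volume : Measure ℝ))
      (ν := (volume : Measure ℝ))).quasiMeasurePreserving.ae hfg

variable {𝕜 : Type*} [RCLike 𝕜] {a : ℝ} {f g : ℝ × ℝ → 𝕜} {φ : ℝ → ℝ≥0∞}

theorem aeHolderSections_lipSeminorm (a : ℝ) (f : ℝ × ℝ → 𝕜) :
    AEHolderSections a f fun y => lipSeminorm a (ySection f y) := by
  refine Eventually.of_forall fun y h hh => ?_
  have h1 : ENNReal.ofReal (h ^ (-a)) *
      eLpNorm (fun t => ySection f y (t + h) - ySection f y t) ∞ volume ≤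
        lipSeminorm a (ySection f y) :=
    le_iSup₂ (f := fun (h : ℝ) (_ : 0 < h) => ENNReal.ofReal (h ^ (-a)) *
      eLpNorm (fun t => ySection f y (t + h) - ySection f y t) ∞ volume) h hh
  filter_upwards [enorm_ae_le_eLpNormEssSup (fun t => ySection f y (t + h) - ySection f y t) volume]
    with x hx
  rw [← eLpNorm_exponent_top] at hx
  refine hx.trans ?_
  refine le_trans (le_of_eq ?_) (mul_le_mul_left h1 _)
  rw [mul_right_comm, ← ENNReal.ofReal_mul (by positivity), ← Real.rpow_add hh]
  simp

theorem AEHolderSections.congr (H : AEHolderSections a f φ) (hfg : f =ᵐ[volume] g) :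
    AEHolderSections a g φ := by
  filter_upwards [H, ae_ySection_eq hfg] with y hy hyfg h hh
  filter_upwards [hy h hh, hyfg,
    (measurePreserving_add_right (volume : Measure ℝ) h).quasiMeasurePreserving.ae hyfg]
    with x hx h1 h2
  rwa [← h1, ← h2]

theorem ae_ae_enorm_le_lipNorm (a : ℝ) (hfg : f =ᵐ[volume] g) :
    ∀ᵐ y : ℝ, ∀ᵐ x : ℝ, ‖g (x, y)‖ₑ ≤ lipNorm a (ySection f y) := by
  filter_upwards [ae_ySection_eq hfg] with y hy
  filter_upwards [hy, enorm_ae_le_eLpNormEssSup (ySection f y) volume] with x h1 h2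
  rw [← h1]
  exact h2.trans (by rw [← eLpNorm_exponent_top]; exact le_self_add)

theorem ae_mem_toMeasurable_of_lt (hg : StronglyMeasurable g)
    (h : ∀ᵐ y : ℝ, ∀ᵐ x : ℝ, ‖g (x, y)‖ₑ ≤ φ y) (s : ℝ≥0∞) :
    ∀ᵐ z : ℝ × ℝ, s < ‖g z‖ₑ → z.2 ∈ toMeasurable volume {y | s < φ y} := by
  have hgm := hg.measurable
  have hq : ∀ᵐ q : ℝ × ℝ, s < ‖g (q.2, q.1)‖ₑ → q.1 ∈ toMeasurable volume {y | s < φ y} := by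
    rw [Measure.volume_eq_prod, Measure.ae_prod_iff_ae_ae]
    · filter_upwards [h] with y hy
      filter_upwards [hy] with x hx hs
      exact subset_toMeasurable _ _ (hs.trans_le hx)
    · refine MeasurableSet.imp (measurableSet_lt (by fun_prop) (by fun_prop)) ?_
      exact (measurableSet_toMeasurable _ _).preimage (by fun_prop)
  exact (Measure.measurePreserving_swap (μ := (volume : Measure ℝ))
      (ν := (volume : Measure ℝ))).quasiMeasurePreserving.ae hq

/-- Up to a null set, the superlevel set of `g` lies in the product of measurable hulls of those of
`ψ₂` and `ψ₁`. -/
theorem distribFn_lt_top_of_ae_le (hg : StronglyMeasurable g) {ψ₁ ψ₂ : ℝ → ℝ≥0∞}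
    (h₁ : ∀ᵐ y : ℝ, ∀ᵐ x : ℝ, ‖g (x, y)‖ₑ ≤ ψ₁ y)
    (h₂ : ∀ᵐ x : ℝ, ∀ᵐ y : ℝ, ‖g (x, y)‖ₑ ≤ ψ₂ x) {s : ℝ≥0∞}
    (hs₁ : distribFn ψ₁ volume s < ∞) (hs₂ : distribFn ψ₂ volume s < ∞) :
    distribFn g volume s < ∞ := by
  have m1 := ae_mem_toMeasurable_of_lt hg h₁ s
  have m2 := (Measure.measurePreserving_swap (μ := (volume : Measure ℝ))
      (ν := (volume : Measure ℝ))).quasiMeasurePreserving.ae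
    (ae_mem_toMeasurable_of_lt (hg.comp_measurable measurable_swap) h₂ s)
  have hle : distribFn g volume s ≤ volume
      (toMeasurable volume {x | s < ψ₂ x} ×ˢ toMeasurable volume {y | s < ψ₁ y}) := by
    refine measure_mono_ae ?_
    filter_upwards [m1, m2] with z hz1 hz2 hz
    exact ⟨hz2 hz, hz1 hz⟩
  refine hle.trans_lt ?_
  rw [Measure.volume_eq_prod, Measure.prod_prod, measure_toMeasurable, measure_toMeasurable]
  exact ENNReal.mul_lt_top hs₂ hs₁

theorem distribFn_congr (hfg : f =ᵐ[volume] g) (s : ℝ≥0∞) :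
    distribFn f volume s = distribFn g volume s := by
  refine measure_congr ?_
  filter_upwards [hfg] with z hz
  change (s < ‖f z‖ₑ) = (s < ‖g z‖ₑ)
  rw [hz]

end Sections

end LipSections

open LipSections Filter Topology in
theorem theorem2p1 {𝕜 : Type*} [RCLike 𝕜] (p : ℝ) (hp : 1 ≤ p) :
    ∃ c : ℝ≥0, ∀ f : ℝ × ℝ → 𝕜, LipSections.MemU p f →
      ∀ φ₁ φ₂ : ℝ → ℝ≥0∞,
        (φ₁ = fun y => LipSections.lipSeminorm (1 / p) (LipSections.ySection f y)) →
        (φ₂ = fun x => LipSections.lipSeminorm (1 / p) (LipSections.xSection f x)) →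
        LipSections.MemS0 f volume ∧
        eLpNorm f ∞ volume ≤
          c * (LipSections.lorentzNorm φ₁ p 1 volume + LipSections.lorentzNorm φ₂ p 1 volume) ∧
        ∃ fbar : ℝ × ℝ → 𝕜,
          fbar =ᵐ[volume] f ∧ UniformContinuous fbar ∧ (∃ M : ℝ, ∀ z, ‖fbar z‖ ≤ M) ∧
          ∀ δ : ℝ, 0 < δ →
            LipSections.modCont fbar δ ≤
              c * ∫⁻ t in Ioc (0 : ℝ) δ,
                (LipSections.rearr φ₁ volume t + LipSections.rearr φ₂ volume t) *
                  ENNReal.ofReal (t ^ (1 / p - 1)) := by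
  have ha : 0 < 1 / p := by positivity
  have ha1 : 1 / p ≤ 1 := (div_le_one (by linarith)).2 hp
  -- Two chains of cost 8 each, the middle link being absorbed by one of them; the sup bound needs
  -- only 8.
  refine ⟨16, fun f hU φ₁ φ₂ hφ₁ hφ₂ => ?_⟩
  obtain ⟨g, hg, hfg⟩ := hU.aestronglyMeasurable
  have hg₁ : ∀ᵐ y : ℝ, ∀ᵐ x : ℝ, ‖g (x, y)‖ₑ ≤ lipNorm (1 / p) (ySection f y) :=
    ae_ae_enorm_le_lipNorm (1 / p) hfg
  have hg₂ : ∀ᵐ x : ℝ, ∀ᵐ y : ℝ, ‖g (x, y)‖ₑ ≤ lipNorm (1 / p) (xSection f x) :=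
    (ae_ae_enorm_le_lipNorm (1 / p) (ae_swap hfg)).mono fun x hx => hx
  have hS : ∀ y : ℝ, 0 < y → distribFn g volume (ENNReal.ofReal y) < ∞ := by
    intro y hy
    have d₁ := hU.memLorentz_ySection.memS0.distribFn_lt_top y hy
    have d₂ := hU.memLorentz_xSection.memS0.distribFn_lt_top y hy
    exact distribFn_lt_top_of_ae_le hg hg₁ hg₂ d₁ d₂
  have H₁ : AEHolderSections (1 / p) g φ₁ :=
    hφ₁ ▸ (aeHolderSections_lipSeminorm (1 / p) f).congr hfg
  have H₂ : AEHolderSections (1 / p) (g ∘ Prod.swap) φ₂ :=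
    hφ₂ ▸ (aeHolderSections_lipSeminorm (1 / p) (f ∘ Prod.swap)).congr (ae_swap hfg)
  set B := lorentzNorm φ₁ p 1 volume + lorentzNorm φ₂ p 1 volume with hBdef
  have hBint := lintegral_rearr_add φ₁ φ₂ p
  have hBfin : B < ∞ := by
    refine ENNReal.add_lt_top.2 ⟨?_, ?_⟩
    · refine (lorentzNorm_mono (fun y => ?_) p).trans_lt
        hU.memLorentz_ySection.lorentzNorm_lt_top
      rw [hφ₁]
      exact le_add_self
    · refine (lorentzNorm_mono (fun x => ?_) p).trans_lt
        hU.memLorentz_xSection.lorentzNorm_lt_top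
      rw [hφ₂]
      exact le_add_self
  have hB : ∀ r, rearrInt (1 / p) φ₁ φ₂ r ≤ B := fun r =>
    (lintegral_mono_set (fun t ht => ht.1)).trans_eq hBint
  have hD := ae_isMostlyContinuousAt g
  have hle : ∀ z, IsMostlyContinuousAt g z → ‖g z‖ₑ ≤ 8 * B := fun z hz =>
    enorm_le_of_distribFn_lt_top hg ha ha1 H₁ H₂ hS hz hB
  have hlim : Tendsto (fun r => 16 * rearrInt (1 / p) φ₁ φ₂ r) (𝓝[>] 0) (𝓝 0) := by
    have h0 : Tendsto (rearrInt (1 / p) φ₁ φ₂) (𝓝[>] 0) (𝓝 0) :=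
      weightedInt_tendsto_zero (by rw [hBint]; exact hBfin.ne)
    simpa using ENNReal.Tendsto.const_mul h0 (Or.inr (ENNReal.ofNat_ne_top (n := 16)))
  obtain ⟨F, hF, hFD, hFω⟩ := exists_uniformContinuous_of_dense
    (Measure.dense_of_ae hD) hlim fun z hz w hw r hr hzw =>
      enorm_sub_le_of_dist_le hg ha ha1 H₁ H₂ hz hw hr hzw
  have hFg : F =ᵐ[volume] g := hD.mono hFD
  have hFB : ∀ z, ‖F z‖ₑ ≤ 8 * B := by
    have hclosed : IsClosed {z | ‖F z‖ₑ ≤ 8 * B} := by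
      have := hF.continuous
      exact isClosed_le (by fun_prop) continuous_const
    have hsub : {z | IsMostlyContinuousAt g z} ⊆ {z | ‖F z‖ₑ ≤ 8 * B} := fun w hw => by
      change ‖F w‖ₑ ≤ 8 * B
      rw [hFD w hw]
      exact hle w hw
    intro z
    have hz := closure_minimal hsub hclosed (Measure.dense_of_ae hD z)
    rwa [mem_ofPred_eq] at hz
  refine ⟨⟨hU.aestronglyMeasurable, by simp, fun y hy => ?_⟩, ?_, F, hFg.trans hfg.symm, hF,
    ⟨(8 * B).toReal, fun z => ?_⟩, fun δ hδ => ?_⟩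
  · rw [distribFn_congr hfg]
    exact hS y hy
  · rw [eLpNorm_congr_ae hfg, eLpNorm_exponent_top]
    refine eLpNormEssSup_le_of_ae_enorm_bound ?_
    filter_upwards [hD] with z hz
    refine (hle z hz).trans (mul_le_mul' ?_ le_rfl)
    norm_num
  · rw [← toReal_enorm]
    exact ENNReal.toReal_mono (ENNReal.mul_lt_top (by simp) hBfin).ne (hFB z)
  · refine iSup_le fun x => iSup_le fun y => iSup_le fun h => iSup_le fun hh =>
      iSup_le fun k => iSup_le fun hk => ?_
    refine hFω _ _ δ hδ ?_
    rw [Prod.dist_eq]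
    simp [abs_of_nonneg hh.1, abs_of_nonneg hk.1, hh.2, hk.2]
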